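/- Let $0<\lambda<1$ and $c\in\mathbb{R}$, put $I=[0,1]$, and let $K\subset\mathbb{R}$ be the attractor of the maps $$f_1(x)=\lambda x,\qquad f_2(x)=\lambda x+c-\lambda,\qquad f_3(x)=\lambda x+1-\lambda,$$ that is, the unique nonempty compact set with $K=f_1(K)\cup f_2(K)\cup f_3(K)$. Assume that $I$ is the convex hull of $K$, that $f_1(I)\cap f_2(I)\neq\emptyset$, and that $(f_1(I)\cup f_2(I))\cap f_3(I)=\emptyset$. Then the following three conditions are equivalent: 1. for every $u\in[0,1]$ there are $x,y\in K$ with $u=x\cdot y$; 2. for every $u\in[0,1]$ there are $x_1,x_2,\dots,x_{10}\in K$ with $x_8\neq 0$ and $$u=x_1+x_2=x_3-x_4=x_5\cdot x_6=\frac{x_7}{x_8}=\sqrt{x_9}+\sqrt{x_{10}};$$ 3. $c\geq(1-\lambda)^2$. -/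

import Mathlib

/-- `K` is the attractor (self-similar set) of the finite family of maps `f` on `ℝ`: it is a
nonempty compact set with `K = ⋃ i, f i '' K`. For a finite family of contractions there is exactly
one such set. -/
structure IsAttractor {ι : Type*} (f : ι → ℝ → ℝ) (K : Set ℝ) : Prop where
  isCompact : IsCompact K
  nonempty : K.Nonempty
  eq_iUnion : K = ⋃ i, f i '' K

/-- The three similitudes `f₁(x) = r x`, `f₂(x) = r x + c - r`, `f₃(x) = r x + 1 - r`, indexed by
`0, 1, 2`. -/
def overlapIFS (r c : ℝ) : Fin 3 → ℝ → ℝ :=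
  ![fun x => r * x, fun x => r * x + c - r, fun x => r * x + 1 - r]

open Set Filter Topology

/-! The hypotheses force `r ≤ c ≤ 2 * r` and `c < 1 - r`, so each cylinder of length `t` loses at
the next level only one gap, of length `(1 - r - c) * t`.

Necessity of `(1 - r) ^ 2 ≤ c`: points of `K` are at most `c` or at least `1 - r`, so no product
lies strictly between `c` and `(1 - r) ^ 2`.

Sufficiency is a Newhouse-type nesting argument. A solution of `F (x, y) = 0` in a product of two
equal cylinders is moved into a product of children, and compactness turns the nested boxes into a
solution in `K × K` (`exists_zero`). The move works if the values of `F` on the four rectangles left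
by the gaps overlap in a chain (`exists_zero_gapSet`). For sums and differences the whole unit
square can serve as the initial box. For products, quotients and square roots, self-similarity
reduces the target to a fundamental domain, covered by finitely many boxes kept off the axes. Square
roots are the hardest case: if `c - r` is small, the middle copy comes too close to `0` and smaller
cylinders replace it. -/

/-- The arithmetic and structural consequences of the hypotheses under which the arithmetic
operations on the attractor `K` fill `[0, 1]`. -/
structure ThickSystem (r c : ℝ) (K : Set ℝ) : Prop where
  pos : 0 < r
  le : r ≤ c
  le_two : c ≤ 2 * r
  lt : c < 1 - r
  thick : (1 - r) ^ 2 ≤ c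
  compact : IsCompact K
  zero_mem : (0 : ℝ) ∈ K
  one_mem : (1 : ℝ) ∈ K
  left_mem : ∀ x ∈ K, r * x ∈ K
  mid_mem : ∀ x ∈ K, r * x + c - r ∈ K
  right_mem : ∀ x ∈ K, r * x + 1 - r ∈ K

/-- `[a, a + t]` is the hull of a copy of `K` inside `K`. -/
def IsCylinder (K : Set ℝ) (a t : ℝ) : Prop := ∀ k ∈ K, a + t * k ∈ K

/-- What is left of `[a, a + t]` after removing the gap between the second and third child. -/
def gapSet (r c a t : ℝ) : Set ℝ := Icc a (a + c * t) ∪ Icc (a + (1 - r) * t) (a + t)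

/-! ### Cylinders, gaps and nested boxes. -/

namespace ThickSystem

variable {r c : ℝ} {K : Set ℝ}

theorem lt_half (h : ThickSystem r c K) : r < 1 / 2 := by linarith [h.le, h.lt]

/-- This is the thickness condition rewritten, because `(1 - r) - (1 - r) ^ 2 = r * (1 - r)`. -/
theorem gap_le (h : ThickSystem r c K) : 1 - r - c ≤ r * (1 - r) := by nlinarith [h.thick]

theorem gap_le_ratio (h : ThickSystem r c K) : 1 - r - c ≤ r := by
  nlinarith [h.gap_le, h.pos]

theorem gap_le_main (h : ThickSystem r c K) : 1 - r - c ≤ c := by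
  linarith [h.gap_le_ratio, h.le]

theorem isCylinder_whole (_h : ThickSystem r c K) : IsCylinder K 0 1 := fun k hk => by simpa

theorem isCylinder_left (h : ThickSystem r c K) {a t : ℝ} (H : IsCylinder K a t) :
    IsCylinder K a (r * t) := fun k hk => by
  have := H _ (h.left_mem k hk)
  rwa [show a + r * t * k = a + t * (r * k) by ring]

theorem isCylinder_mid (h : ThickSystem r c K) {a t : ℝ} (H : IsCylinder K a t) :
    IsCylinder K (a + (c - r) * t) (r * t) := fun k hk => by
  have := H _ (h.mid_mem k hk)
  rwa [show a + (c - r) * t + r * t * k = a + t * (r * k + c - r) by ring]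

theorem isCylinder_right (h : ThickSystem r c K) {a t : ℝ} (H : IsCylinder K a t) :
    IsCylinder K (a + (1 - r) * t) (r * t) := fun k hk => by
  have := H _ (h.right_mem k hk)
  rwa [show a + (1 - r) * t + r * t * k = a + t * (r * k + 1 - r) by ring]

theorem exists_child (h : ThickSystem r c K) {a t x : ℝ} (ht : 0 < t) (H : IsCylinder K a t)
    (hx : x ∈ gapSet r c a t) :
    ∃ a', IsCylinder K a' (r * t) ∧ a ≤ a' ∧ a' + r * t ≤ a + t ∧ x ∈ Icc a' (a' + r * t) := by
  have h1 := h.pos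
  have h2 := h.le
  have h3 := h.le_two
  have h4 := h.lt
  rcases hx with ⟨hx1, hx2⟩ | ⟨hx1, hx2⟩
  · rcases le_total x (a + r * t) with h5 | h5
    · exact ⟨a, h.isCylinder_left H, le_rfl, by nlinarith, hx1, h5⟩
    · exact ⟨_, h.isCylinder_mid H, by nlinarith, by nlinarith, by nlinarith, by nlinarith⟩
  · exact ⟨_, h.isCylinder_right H, by nlinarith, by nlinarith, hx1, by nlinarith⟩

/-- A zero of `F` in a product of two cylinders of equal size yields a zero in `K × K` provided
zeros never get lost in the gaps. -/
theorem exists_zero (h : ThickSystem r c K) {F : ℝ × ℝ → ℝ} (hF : Continuous F) {a₀ b₀ t₀ : ℝ}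
    (ht₀ : 0 < t₀) (ha₀ : IsCylinder K a₀ t₀) (hb₀ : IsCylinder K b₀ t₀)
    (start : ∃ p ∈ Icc a₀ (a₀ + t₀) ×ˢ Icc b₀ (b₀ + t₀), F p = 0)
    (step : ∀ a b t, 0 < t → a₀ ≤ a → a + t ≤ a₀ + t₀ → b₀ ≤ b → b + t ≤ b₀ + t₀ →
      (∃ p ∈ Icc a (a + t) ×ˢ Icc b (b + t), F p = 0) →
      ∃ p ∈ gapSet r c a t ×ˢ gapSet r c b t, F p = 0) :
    ∃ x ∈ K, ∃ y ∈ K, b₀ ≤ y ∧ F (x, y) = 0 := by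
  have key : ∀ n : ℕ, ∃ a b, IsCylinder K a (r ^ n * t₀) ∧ IsCylinder K b (r ^ n * t₀) ∧
      a₀ ≤ a ∧ a + r ^ n * t₀ ≤ a₀ + t₀ ∧ b₀ ≤ b ∧ b + r ^ n * t₀ ≤ b₀ + t₀ ∧
      ∃ p ∈ Icc a (a + r ^ n * t₀) ×ˢ Icc b (b + r ^ n * t₀), F p = 0 := by
    intro n
    induction n with
    | zero =>
      exact ⟨a₀, b₀, by simpa, by simpa, le_rfl, by simp, le_rfl, by simp, by simpa using start⟩
    | succ n ih =>
      obtain ⟨a, b, ha, hb, h1, h2, h3, h4, hp⟩ := ih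
      have hpos : 0 < r ^ n * t₀ := mul_pos (pow_pos h.pos n) ht₀
      obtain ⟨⟨x, y⟩, ⟨hx, hy⟩, hxy⟩ := step a b _ hpos h1 h2 h3 h4 hp
      obtain ⟨a', ha', h5, h6, hx'⟩ := h.exists_child hpos ha hx
      obtain ⟨b', hb', h7, h8, hy'⟩ := h.exists_child hpos hb hy
      rw [show r ^ (n + 1) * t₀ = r * (r ^ n * t₀) by ring]
      exact ⟨a', b', ha', hb', h1.trans h5, h6.trans h2, h3.trans h7, h8.trans h4, (x, y),
        ⟨hx', hy'⟩, hxy⟩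
  choose a b ha hb _ _ h3 _ p hp hFp using key
  -- Left endpoints of cylinders lie in `K` because `0` does; the zeros `p n` need not, but they
  -- share the limit of the corners.
  have haK : ∀ n, a n ∈ K := fun n => by simpa using ha n 0 h.zero_mem
  have hbK : ∀ n, b n ∈ K := fun n => by simpa using hb n 0 h.zero_mem
  obtain ⟨z, hz, φ, hφ, hlim⟩ := (h.compact.prod h.compact).tendsto_subseq
    (x := fun n => (a n, b n)) (fun n => ⟨haK n, hbK n⟩)
  have hr : Tendsto (fun n => r ^ n * t₀) atTop (𝓝 0) := by
    simpa using (tendsto_pow_atTop_nhds_zero_of_lt_one h.pos.le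
      (by linarith [h.lt_half])).mul_const t₀
  have hl1 : Tendsto (fun n => a (φ n)) atTop (𝓝 z.1) :=
    (continuous_fst.tendsto z).comp hlim
  have hl2 : Tendsto (fun n => b (φ n)) atTop (𝓝 z.2) :=
    (continuous_snd.tendsto z).comp hlim
  have hr' := hr.comp hφ.tendsto_atTop
  have hp1 : Tendsto (fun n => (p (φ n)).1) atTop (𝓝 z.1) :=
    tendsto_of_tendsto_of_tendsto_of_le_of_le hl1 (by simpa using hl1.add hr')
      (fun n => (hp (φ n)).1.1) (fun n => (hp (φ n)).1.2)
  have hp2 : Tendsto (fun n => (p (φ n)).2) atTop (𝓝 z.2) :=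
    tendsto_of_tendsto_of_tendsto_of_le_of_le hl2 (by simpa using hl2.add hr')
      (fun n => (hp (φ n)).2.1) (fun n => (hp (φ n)).2.2)
  have hpl : Tendsto (fun n => F (p (φ n))) atTop (𝓝 (F z)) :=
    (hF.tendsto z).comp (hp1.prodMk_nhds hp2)
  refine ⟨z.1, hz.1, z.2, hz.2, ge_of_tendsto' hl2 fun n => h3 _, ?_⟩
  simp only [hFp] at hpl
  exact (tendsto_nhds_unique hpl tendsto_const_nhds)

end ThickSystem

theorem exists_zero_of_nonpos_of_nonneg {F : ℝ × ℝ → ℝ} (hF : Continuous F) {p p' q q' : ℝ}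
    {P Q : ℝ × ℝ} (hP : P ∈ Icc p p' ×ˢ Icc q q') (hQ : Q ∈ Icc p p' ×ˢ Icc q q')
    (hP0 : F P ≤ 0) (hQ0 : 0 ≤ F Q) : ∃ z ∈ Icc p p' ×ˢ Icc q q', F z = 0 :=
  ((convex_Icc p p').prod (convex_Icc q q')).isPreconnected.intermediate_value hP hQ
    hF.continuousOn ⟨hP0, hQ0⟩

namespace ThickSystem

variable {r c : ℝ} {K : Set ℝ}

/-- Write L and R for the pieces left and right of a gap. In the order L×L, R×L, L×R, R×R, each of
`hα`, `hβ`, `hγ` puts the lower corner value of a rectangle below the upper corner value of its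
predecessor. Hence some rectangle has corner values of both signs, and it is connected. -/
theorem exists_zero_gapSet (h : ThickSystem r c K) {F : ℝ × ℝ → ℝ} (hF : Continuous F)
    {a b t : ℝ} (ht : 0 < t) (h0 : F (a, b) ≤ 0) (h1 : 0 ≤ F (a + t, b + t))
    (hα : F (a + (1 - r) * t, b) ≤ F (a + c * t, b + c * t))
    (hβ : F (a, b + (1 - r) * t) ≤ F (a + t, b + c * t))
    (hγ : F (a + (1 - r) * t, b + (1 - r) * t) ≤ F (a + c * t, b + t)) :
    ∃ p ∈ gapSet r c a t ×ˢ gapSet r c b t, F p = 0 := by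
  have hc : 0 ≤ c * t := mul_nonneg (h.pos.le.trans h.le) ht.le
  have hr : (1 - r) * t ≤ t := by nlinarith [h.pos]
  have sub : ∀ {A A' B B' : Set ℝ}, A ⊆ A' → B ⊆ B' → (∃ z ∈ A ×ˢ B, F z = 0) →
      ∃ z ∈ A' ×ˢ B', F z = 0 := fun hA hB ⟨z, hz, e⟩ => ⟨z, prod_mono hA hB hz, e⟩
  rcases le_total 0 (F (a + c * t, b + c * t)) with h2 | h2
  · refine sub subset_union_left subset_union_left
      (exists_zero_of_nonpos_of_nonneg hF ?_ ?_ h0 h2) <;> simp [hc]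
  rcases le_total 0 (F (a + t, b + c * t)) with h3 | h3
  · refine sub subset_union_right subset_union_left
      (exists_zero_of_nonpos_of_nonneg hF ?_ ?_ (hα.trans h2) h3) <;> simp [hc, hr]
  rcases le_total 0 (F (a + c * t, b + t)) with h4 | h4
  · refine sub subset_union_left subset_union_right
      (exists_zero_of_nonpos_of_nonneg hF ?_ ?_ (hβ.trans h3) h4) <;> simp [hc, hr]
  · refine sub subset_union_right subset_union_right
      (exists_zero_of_nonpos_of_nonneg hF ?_ ?_ (hγ.trans h4) h1) <;> simp [hr]

/-- For a symmetric function it suffices to check the gap conditions when `b ≤ a`. -/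
theorem exists_zero_gapSet_of_symm (h : ThickSystem r c K) {F : ℝ × ℝ → ℝ} (hF : Continuous F)
    (hsymm : ∀ x y, F (x, y) = F (y, x)) {P : ℝ → ℝ → Prop} {t : ℝ} (ht : 0 < t)
    (hα : ∀ a b, P a b → b ≤ a → F (a + (1 - r) * t, b) ≤ F (a + c * t, b + c * t))
    (hβ : ∀ a b, P a b → b ≤ a → F (a, b + (1 - r) * t) ≤ F (a + t, b + c * t))
    (hγ : ∀ a b, P a b → b ≤ a →
      F (a + (1 - r) * t, b + (1 - r) * t) ≤ F (a + c * t, b + t))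
    {a b : ℝ} (hab : P a b) (hba : P b a) (h0 : F (a, b) ≤ 0) (h1 : 0 ≤ F (a + t, b + t)) :
    ∃ p ∈ gapSet r c a t ×ˢ gapSet r c b t, F p = 0 := by
  rcases le_total b a with hle | hle
  · exact h.exists_zero_gapSet hF ht h0 h1 (hα a b hab hle) (hβ a b hab hle) (hγ a b hab hle)
  · obtain ⟨⟨x, y⟩, ⟨hx, hy⟩, e⟩ := h.exists_zero_gapSet hF ht (by rwa [hsymm]) (by rwa [hsymm])
      (hα b a hba hle) (hβ b a hba hle) (hγ b a hba hle)
    exact ⟨(y, x), ⟨hy, hx⟩, by rwa [hsymm]⟩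

end ThickSystem

/-- A property stable under multiplication by `ρ` holds on `(0, m]` once it holds on
`[ρ * m, m]`. -/
theorem forall_of_fundamental_domain {S : ℝ → Prop} {ρ m : ℝ} (hρ0 : 0 < ρ) (hρ1 : ρ < 1)
    (hm : 0 < m) (hS : ∀ u, S u → S (ρ * u)) (H : ∀ u ∈ Icc (ρ * m) m, S u) {u : ℝ}
    (hu0 : 0 < u) (hum : u ≤ m) : S u := by
  obtain ⟨n, hn1, hn2⟩ := exists_nat_pow_near_of_lt_one (div_pos hu0 hm)
    ((div_le_one hm).2 hum) hρ0 hρ1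
  have key : ∀ n : ℕ, ∀ v, S v → S (ρ ^ n * v) := by
    intro n
    induction n with
    | zero => intro v hv; simpa
    | succ n ih =>
      intro v hv
      rw [show ρ ^ (n + 1) * v = ρ * (ρ ^ n * v) by ring]
      exact hS _ (ih v hv)
  have hpos : 0 < ρ ^ n := pow_pos hρ0 n
  have := key n (u / ρ ^ n) (H _ ⟨?_, ?_⟩)
  · rwa [mul_div_cancel₀ _ hpos.ne'] at this
  · rw [le_div_iff₀ hpos]
    rw [lt_div_iff₀ hm, pow_succ] at hn1
    linarith
  · rw [div_le_iff₀ hpos]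
    rw [div_le_iff₀ hm] at hn2
    nlinarith [hn2]

/-! ### Differences, sums, quotients and products. -/

namespace ThickSystem

variable {r c : ℝ} {K : Set ℝ}

/-- The slope `κ = 1` gives differences, and `v = 0` gives the quotient `κ = x / y`. The function
decreases in `y`, so the chain of rectangles is now L×R, L×L, R×R, R×L. -/
theorem exists_linear (h : ThickSystem r c K) {κ v a₀ b₀ t₀ : ℝ} (hκ : r ≤ κ) (hκ1 : κ ≤ 1)
    (ht₀ : 0 < t₀) (ha₀ : IsCylinder K a₀ t₀) (hb₀ : IsCylinder K b₀ t₀)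
    (hlo : a₀ - κ * (b₀ + t₀) ≤ v) (hhi : v ≤ a₀ + t₀ - κ * b₀) :
    ∃ x ∈ K, ∃ y ∈ K, b₀ ≤ y ∧ x - κ * y = v := by
  have hF : Continuous fun p : ℝ × ℝ => p.1 - κ * p.2 - v := by fun_prop
  have hκ0 : 0 < κ := h.pos.trans_le hκ
  have key := h.exists_zero hF ht₀ ha₀ hb₀
    (exists_zero_of_nonpos_of_nonneg hF (P := (a₀, b₀ + t₀)) (Q := (a₀ + t₀, b₀))
      (by simp [ht₀.le]) (by simp [ht₀.le]) (by dsimp only; linarith) (by dsimp only; linarith))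
  obtain ⟨x, hx, y, hy, hby, e⟩ := key (by
    rintro a b t ht - - - - ⟨⟨x, y⟩, ⟨⟨hx1, hx2⟩, hy1, hy2⟩, e⟩
    dsimp only at hx1 hx2 hy1 hy2 e
    have hlo : a - κ * (b + t) - v ≤ 0 := by nlinarith
    have hhi : 0 ≤ a + t - κ * b - v := by nlinarith
    have hc : 0 ≤ c * t := mul_nonneg (h.pos.le.trans h.le) ht.le
    have hr : (1 - r) * t ≤ t := by nlinarith [h.pos]
    have hg : (1 - r - c) * κ ≤ r := by nlinarith [h.gap_le_ratio, h.lt]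
    have hg' : (1 - r - c) * κ ≤ c := hg.trans h.le
    have hgκ : 1 - r - c ≤ κ := h.gap_le_ratio.trans hκ
    have sub : ∀ {A A' B B' : Set ℝ}, A ⊆ A' → B ⊆ B' →
        (∃ z ∈ A ×ˢ B, z.1 - κ * z.2 - v = 0) → ∃ z ∈ A' ×ˢ B', z.1 - κ * z.2 - v = 0 :=
      fun hA hB ⟨z, hz, e⟩ => ⟨z, prod_mono hA hB hz, e⟩
    rcases le_total 0 (a + c * t - κ * (b + (1 - r) * t) - v) with h2 | h2
    · refine sub subset_union_left subset_union_right (exists_zero_of_nonpos_of_nonneg hF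
        (P := (a, b + t)) (Q := (a + c * t, b + (1 - r) * t)) ?_ ?_ hlo h2) <;> simp [hc, hr]
    rcases le_total 0 (a + c * t - κ * b - v) with h3 | h3
    · refine sub subset_union_left subset_union_left (exists_zero_of_nonpos_of_nonneg hF
        (P := (a, b + c * t)) (Q := (a + c * t, b)) ?_ ?_ ?_ h3)
      · simp [hc]
      · simp [hc]
      · dsimp only
        nlinarith [mul_le_mul_of_nonneg_right hg' ht.le]
    rcases le_total 0 (a + t - κ * (b + (1 - r) * t) - v) with h4 | h4
    · refine sub subset_union_right subset_union_right (exists_zero_of_nonpos_of_nonneg hF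
        (P := (a + (1 - r) * t, b + t)) (Q := (a + t, b + (1 - r) * t)) ?_ ?_ ?_ h4)
      · simp [hr]
      · simp [hr]
      · dsimp only
        nlinarith [mul_le_mul_of_nonneg_right hgκ ht.le]
    · refine sub subset_union_right subset_union_left (exists_zero_of_nonpos_of_nonneg hF
        (P := (a + (1 - r) * t, b + c * t)) (Q := (a + t, b)) ?_ ?_ ?_ hhi)
      · simp [hc, hr]
      · simp [hc, hr]
      · dsimp only
        nlinarith [mul_le_mul_of_nonneg_right hg ht.le])
  exact ⟨x, hx, y, hy, hby, sub_eq_zero.1 e⟩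

theorem exists_sub (h : ThickSystem r c K) {u : ℝ} (hu : u ∈ Icc (0 : ℝ) 1) :
    ∃ x ∈ K, ∃ y ∈ K, u = x - y := by
  obtain ⟨x, hx, y, hy, -, e⟩ := h.exists_linear (κ := 1) (v := u) (by linarith [h.lt_half]) le_rfl
    one_pos h.isCylinder_whole h.isCylinder_whole (by linarith [hu.1]) (by linarith [hu.2])
  exact ⟨x, hx, y, hy, by linarith⟩

theorem exists_add (h : ThickSystem r c K) {u : ℝ} (hu : u ∈ Icc (0 : ℝ) 1) :
    ∃ x ∈ K, ∃ y ∈ K, u = x + y := by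
  have hF : Continuous fun p : ℝ × ℝ => p.1 + p.2 - u := by fun_prop
  have key := h.exists_zero hF one_pos h.isCylinder_whole h.isCylinder_whole
    (exists_zero_of_nonpos_of_nonneg hF (P := (0, 0)) (Q := (0 + 1, 0 + 1)) (by simp) (by simp)
      (by simpa using hu.1) (by dsimp only; linarith [hu.2]))
  obtain ⟨x, hx, y, hy, -, e⟩ := key (by
    rintro a b t ht - - - - ⟨⟨x, y⟩, ⟨⟨hx1, hx2⟩, hy1, hy2⟩, e⟩
    dsimp only at hx1 hx2 hy1 hy2 e
    have hg := mul_le_mul_of_nonneg_right h.gap_le_ratio ht.le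
    have hg' := mul_le_mul_of_nonneg_right h.gap_le_main ht.le
    have h1 := mul_pos h.pos ht
    have h2 := mul_le_mul_of_nonneg_right h.le ht.le
    refine h.exists_zero_gapSet hF ht ?_ ?_ ?_ ?_ ?_ <;> dsimp only <;> linarith)
  exact ⟨x, hx, y, hy, by dsimp only at e; linarith⟩

theorem exists_div_of_mem (h : ThickSystem r c K) {u : ℝ} (hu : u ∈ Icc r 1) :
    ∃ x ∈ K, ∃ y ∈ K, y ≠ 0 ∧ u = x / y := by
  obtain ⟨hu1, hu2⟩ := hu
  have hr := h.pos
  have hr2 := h.lt_half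
  have hB := h.isCylinder_right h.isCylinder_whole
  have hA := h.isCylinder_mid h.isCylinder_whole
  have : ∃ x ∈ K, ∃ y ∈ K, 0 + (1 - r) * 1 ≤ y ∧ x - u * y = 0 := by
    -- The denominator stays in the right copy, hence away from `0`; the numerator comes from the
    -- middle or the right copy.
    rcases le_total (u * (1 - r)) c with h1 | h1
    · refine h.exists_linear hu1 hu2 (by linarith) hA hB ?_ ?_
      · linarith [h.le_two]
      · linarith
    · refine h.exists_linear hu1 hu2 (by linarith) hB hB ?_ ?_
      · nlinarith [h.thick]
      · nlinarith
  obtain ⟨x, hx, y, hy, hy1, e⟩ := this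
  have hy0 : y ≠ 0 := by
    rintro rfl
    linarith
  exact ⟨x, hx, y, hy, hy0, by rw [eq_div_iff hy0]; linarith⟩

theorem exists_div (h : ThickSystem r c K) {u : ℝ} (hu : u ∈ Icc (0 : ℝ) 1) :
    ∃ x ∈ K, ∃ y ∈ K, y ≠ 0 ∧ u = x / y := by
  rcases hu.1.eq_or_lt with rfl | h0
  · exact ⟨0, h.zero_mem, 1, h.one_mem, one_ne_zero, by simp⟩
  refine forall_of_fundamental_domain (S := fun u => ∃ x ∈ K, ∃ y ∈ K, y ≠ 0 ∧ u = x / y) h.pos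
    (by linarith [h.lt_half]) one_pos ?_ (fun v hv => h.exists_div_of_mem (by simpa using hv))
    h0 hu.2
  rintro v ⟨x, hx, y, hy, hy0, rfl⟩
  exact ⟨r * x, h.left_mem x hx, y, hy, hy0, by ring⟩

theorem exists_mul_of_mem_box (h : ThickSystem r c K) {u a₀ b₀ : ℝ} (hu : r ≤ u)
    (ha₀ : IsCylinder K a₀ r) (hb₀ : IsCylinder K b₀ r) (ha0 : 0 ≤ a₀) (ha1 : a₀ + r ≤ 1)
    (hb0 : 0 ≤ b₀) (hb1 : b₀ + r ≤ 1) (hlo : a₀ * b₀ ≤ u) (hhi : u ≤ (a₀ + r) * (b₀ + r)) :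
    ∃ x ∈ K, ∃ y ∈ K, u = x * y := by
  have hr := h.pos
  have hF : Continuous fun p : ℝ × ℝ => p.1 * p.2 - u := by fun_prop
  have key := h.exists_zero hF hr ha₀ hb₀
    (exists_zero_of_nonpos_of_nonneg hF (P := (a₀, b₀)) (Q := (a₀ + r, b₀ + r))
      (by simp [hr.le]) (by simp [hr.le]) (by dsimp only; linarith) (by dsimp only; linarith))
  obtain ⟨x, hx, y, hy, -, e⟩ := key (by
    rintro a b t ht ha hat hb hbt ⟨⟨x, y⟩, ⟨⟨hx1, hx2⟩, hy1, hy2⟩, e⟩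
    dsimp only at hx1 hx2 hy1 hy2 e
    have htr : t ≤ r := by linarith
    have hg := h.gap_le
    have hg0 : 0 < 1 - r - c := by linarith [h.lt]
    have hc := hr.trans_le h.le
    have hgc := h.gap_le_main
    have hgr := h.gap_le_ratio
    have hthick := h.thick
    have hup : x * y ≤ (a + t) * (b + t) := mul_le_mul hx2 hy2 (by linarith) (by linarith)
    -- The bound `r ≤ b + t` follows from `r ≤ u ≤ (a + t) * (b + t)` and `a + t ≤ 1`; it keeps `b`
    -- large enough for the second overlap.
    refine h.exists_zero_gapSet_of_symm hF (fun x y => by simp only [mul_comm])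
      (P := fun a b => 0 ≤ a ∧ 0 ≤ b ∧ a + t ≤ 1 ∧ r ≤ b + t) ht ?_ ?_ ?_
      (a := a) (b := b) ?_ ?_ ?_ ?_
    · rintro a b ⟨ha, hb, ha1, hbr⟩ hab
      dsimp only
      have h1 : (1 - r - c) * (b * t) ≤ c * (a * t) :=
        mul_le_mul hgc (mul_le_mul_of_nonneg_right hab ht.le) (mul_nonneg hb ht.le) hc.le
      nlinarith [mul_pos hc ht, mul_pos (mul_pos hc ht) (mul_pos hc ht)]
    · rintro a b ⟨ha, hb, ha1, hbr⟩ hab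
      dsimp only
      have h1 : (1 - r - c) * a ≤ b + c * t := by
        nlinarith [mul_le_mul_of_nonneg_left (show a ≤ 1 - t by linarith) hg0.le,
          mul_le_mul_of_nonneg_left htr hr.le]
      nlinarith [mul_le_mul_of_nonneg_right h1 ht.le]
    · rintro a b ⟨ha, hb, ha1, hbr⟩ hab
      dsimp only
      have h1 : (1 - r - c) * (b * t) ≤ r * (a * t) :=
        mul_le_mul hgr (mul_le_mul_of_nonneg_right hab ht.le) (mul_nonneg hb ht.le) hr.le
      -- The `t ^ 2` terms compare as `(1 - r) ^ 2 ≤ c`, the thickness condition itself.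
      nlinarith [mul_le_mul_of_nonneg_right hthick (mul_pos ht ht).le]
    · exact ⟨by linarith, by linarith, by linarith, by nlinarith⟩
    · exact ⟨by linarith, by linarith, by linarith, by nlinarith⟩
    · dsimp only
      nlinarith [mul_le_mul hx1 hy1 (by linarith) (by linarith)]
    · dsimp only
      linarith)
  exact ⟨x, hx, y, hy, by dsimp only at e; linarith⟩

theorem exists_mul (h : ThickSystem r c K) {u : ℝ} (hu : u ∈ Icc (0 : ℝ) 1) :
    ∃ x ∈ K, ∃ y ∈ K, u = x * y := by
  rcases hu.1.eq_or_lt with rfl | h0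
  · exact ⟨0, h.zero_mem, 0, h.zero_mem, by simp⟩
  refine forall_of_fundamental_domain (S := fun u => ∃ x ∈ K, ∃ y ∈ K, u = x * y) h.pos
    (by linarith [h.lt_half]) one_pos ?_ ?_ h0 hu.2
  · rintro v ⟨x, hx, y, hy, rfl⟩
    exact ⟨r * x, h.left_mem x hx, y, hy, by ring⟩
  rintro v ⟨hv1, hv2⟩
  rw [mul_one] at hv1
  have hr := h.pos
  have hr2 := h.lt_half
  have hle := h.le
  have hlt := h.lt
  have hB : IsCylinder K (1 - r) r := by simpa using h.isCylinder_right h.isCylinder_whole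
  have hA : IsCylinder K (c - r) r := by simpa using h.isCylinder_mid h.isCylinder_whole
  -- Middle times right covers `[r, c]`; right times right covers `[(1 - r) ^ 2, 1]`.
  rcases le_total v c with h1 | h1
  · refine h.exists_mul_of_mem_box hv1 hA hB ?_ ?_ ?_ ?_ ?_ ?_ <;> try linarith
    nlinarith [h.le_two]
  · refine h.exists_mul_of_mem_box hv1 hB hB ?_ ?_ ?_ ?_ ?_ ?_ <;> try linarith
    nlinarith [h.thick]

end ThickSystem

/-! ### Sums of square roots. -/

theorem sqrt_sub_sqrt_le {x y z w : ℝ} (hx : 0 < x) (hy : 0 ≤ y) (hz : 0 < z) (hw : 0 ≤ w)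
    (H : (x - y) * (√z + √w) ≤ (z - w) * (√x + √y)) : √x - √y ≤ √z - √w := by
  have h1 : 0 < √x + √y := add_pos_of_pos_of_nonneg (Real.sqrt_pos.2 hx) (Real.sqrt_nonneg y)
  have h2 : 0 < √z + √w := add_pos_of_pos_of_nonneg (Real.sqrt_pos.2 hz) (Real.sqrt_nonneg w)
  have e1 : x - y = (√x - √y) * (√x + √y) := by
    nlinarith [Real.sq_sqrt hx.le, Real.sq_sqrt hy]
  have e2 : z - w = (√z - √w) * (√z + √w) := by
    nlinarith [Real.sq_sqrt hz.le, Real.sq_sqrt hw]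
  rw [e1, e2] at H
  refine le_of_mul_le_mul_right ?_ (mul_pos h1 h2)
  linarith

theorem half_le_sqrt_sub_sqrt {a s : ℝ} (ha : 0 ≤ a) (hs : 0 ≤ s) (has : a + s ≤ 1) :
    s / 2 ≤ √(a + s) - √a := by
  have h1 : √(a + s) ≤ 1 := Real.sqrt_le_one.2 has
  have h2 : √a ≤ √(a + s) := Real.sqrt_le_sqrt (by linarith)
  nlinarith [Real.sq_sqrt ha, Real.sq_sqrt (add_nonneg ha hs)]

theorem sqrt_one_sub_le {r : ℝ} (hr : r ≤ 2) : √(1 - r) ≤ 1 - r / 2 :=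
  Real.sqrt_le_iff.2 ⟨by linarith, by nlinarith [sq_nonneg r]⟩

theorem exists_sqrt_add_sqrt_eq {a s b t u : ℝ} (hs : 0 ≤ s) (ht : 0 ≤ t) (hlo : √a + √b ≤ u)
    (hhi : u ≤ √(a + s) + √(b + t)) :
    ∃ p ∈ Icc a (a + s) ×ˢ Icc b (b + t), √p.1 + √p.2 - u = 0 :=
  exists_zero_of_nonpos_of_nonneg (F := fun p : ℝ × ℝ => √p.1 + √p.2 - u) (by fun_prop)
    (P := (a, b)) (Q := (a + s, b + t)) (by simp [hs, ht]) (by simp [hs, ht])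
    (by dsimp only; linarith) (by dsimp only; linarith)

namespace ThickSystem

variable {r c : ℝ} {K : Set ℝ}

/-- The two cross conditions bound the ratio of the coordinates, and hence the ratio of the slopes
of the square root; they pass to all sub-boxes. They say `(1 - r - c) * √(a + t) ≤ √b` and its
mirror image, as the second overlap needs. -/
theorem exists_sqrt_of_box (h : ThickSystem r c K) {u a₀ b₀ t₀ : ℝ} (ht₀ : 0 < t₀)
    (ha₀ : IsCylinder K a₀ t₀) (hb₀ : IsCylinder K b₀ t₀)
    (hab : (1 - r - c) ^ 2 * (a₀ + t₀) ≤ b₀) (hba : (1 - r - c) ^ 2 * (b₀ + t₀) ≤ a₀)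
    (ha0 : 0 ≤ a₀) (hb0 : 0 ≤ b₀)
    (start : ∃ p ∈ Icc a₀ (a₀ + t₀) ×ˢ Icc b₀ (b₀ + t₀), √p.1 + √p.2 - u = 0) :
    ∃ x ∈ K, ∃ y ∈ K, u = √x + √y := by
  have hF : Continuous fun p : ℝ × ℝ => √p.1 + √p.2 - u := by fun_prop
  have hr := h.pos
  have hr2 := h.lt_half
  have hg0 : 0 < 1 - r - c := by linarith [h.lt]
  have hc := hr.trans_le h.le
  obtain ⟨x, hx, y, hy, -, e⟩ := h.exists_zero hF ht₀ ha₀ hb₀ start (by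
    rintro a b t ht ha hat hb hbt ⟨⟨x, y⟩, ⟨⟨hx1, hx2⟩, hy1, hy2⟩, e⟩
    dsimp only at hx1 hx2 hy1 hy2 e
    have hct : 0 < c * t := mul_pos hc ht
    have hrt : 0 < r * t := mul_pos hr ht
    have hgt : 0 < (1 - r - c) * t := mul_pos hg0 ht
    refine h.exists_zero_gapSet_of_symm hF (fun x y => by simp only [add_comm])
      (P := fun a b => 0 ≤ a ∧ 0 ≤ b ∧ (1 - r - c) ^ 2 * (a + t) ≤ b) ht ?_ ?_ ?_
      (a := a) (b := b) ⟨by linarith, by linarith, ?_⟩ ⟨by linarith, by linarith, ?_⟩ ?_ ?_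
    · rintro a b ⟨ha, hb, hab⟩ hle
      dsimp only
      have h1 : √(b + c * t) ≤ √(a + (1 - r) * t) := Real.sqrt_le_sqrt (by linarith)
      have h2 : √b ≤ √(a + c * t) := Real.sqrt_le_sqrt (by linarith)
      have := sqrt_sub_sqrt_le (x := a + (1 - r) * t) (y := a + c * t) (z := b + c * t) (w := b)
        (by linarith) (by linarith) (by linarith) hb ?_
      · linarith
      · calc _ = ((1 - r - c) * t) * (√(b + c * t) + √b) := by ring
          _ ≤ (c * t) * (√(a + (1 - r) * t) + √(a + c * t)) :=
            mul_le_mul (mul_le_mul_of_nonneg_right h.gap_le_main ht.le) (add_le_add h1 h2)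
              (by positivity) hct.le
          _ = _ := by ring
    · rintro a b ⟨ha, hb, hab⟩ hle
      dsimp only
      have h0 : (1 - r - c) * √(a + t) ≤ √b := by
        refine Real.le_sqrt_of_sq_le ?_
        rwa [mul_pow, Real.sq_sqrt (by linarith)]
      have h1 : √b ≤ √(b + (1 - r) * t) := Real.sqrt_le_sqrt (by linarith)
      have h2 : √b ≤ √(b + c * t) := Real.sqrt_le_sqrt (by linarith)
      have h3 : √a ≤ √(a + t) := Real.sqrt_le_sqrt (by linarith)
      have := sqrt_sub_sqrt_le (x := b + (1 - r) * t) (y := b + c * t) (z := a + t) (w := a)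
        (by linarith) (by linarith) (by linarith) ha ?_
      · linarith
      · calc _ = t * ((1 - r - c) * √(a + t) + (1 - r - c) * √a) := by ring
          _ ≤ t * (√(b + (1 - r) * t) + √(b + c * t)) := by
            refine mul_le_mul_of_nonneg_left ?_ ht.le
            linarith [mul_le_mul_of_nonneg_left h3 hg0.le]
          _ = _ := by ring
    · rintro a b ⟨ha, hb, hab⟩ hle
      dsimp only
      have hr1 : (0 : ℝ) ≤ 1 - r := by linarith
      have h4 : ∀ {x y : ℝ}, 0 ≤ x → (1 - r) ^ 2 * x ≤ y → (1 - r) * √x ≤ √y := by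
        intro x y hx hxy
        refine Real.le_sqrt_of_sq_le ?_
        rwa [mul_pow, Real.sq_sqrt hx]
      have hsq : (1 - r) ^ 2 ≤ 1 := by nlinarith
      have h1 : (1 - r) * √(b + (1 - r) * t) ≤ √(a + (1 - r) * t) := by
        refine h4 (by linarith) ?_
        nlinarith [mul_le_mul_of_nonneg_right hsq (show 0 ≤ b + (1 - r) * t by linarith)]
      have h2 : (1 - r) * √(b + t) ≤ √(a + c * t) := by
        refine h4 (by linarith) ?_
        nlinarith [mul_le_mul_of_nonneg_right hsq hb, mul_le_mul_of_nonneg_right h.thick ht.le]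
      have := sqrt_sub_sqrt_le (x := a + (1 - r) * t) (y := a + c * t) (z := b + t)
        (w := b + (1 - r) * t) (by linarith) (by linarith) (by linarith) (by linarith) ?_
      · linarith
      · calc _ = ((1 - r - c) * t) * (√(b + t) + √(b + (1 - r) * t)) := by ring
          _ ≤ (r * (1 - r) * t) * (√(b + t) + √(b + (1 - r) * t)) :=
            mul_le_mul_of_nonneg_right (mul_le_mul_of_nonneg_right h.gap_le ht.le)
              (by positivity)
          _ = (r * t) * ((1 - r) * √(b + t) + (1 - r) * √(b + (1 - r) * t)) := by ring
          _ ≤ (r * t) * (√(a + (1 - r) * t) + √(a + c * t)) :=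
            mul_le_mul_of_nonneg_left (by linarith) hrt.le
          _ = _ := by ring
    · exact ((mul_le_mul_of_nonneg_left hat (sq_nonneg _)).trans hab).trans hb
    · exact ((mul_le_mul_of_nonneg_left hbt (sq_nonneg _)).trans hba).trans ha
    · dsimp only
      linarith [Real.sqrt_le_sqrt hx1, Real.sqrt_le_sqrt hy1]
    · dsimp only
      linarith [Real.sqrt_le_sqrt hx2, Real.sqrt_le_sqrt hy2])
  exact ⟨x, hx, y, hy, by dsimp only at e; linarith⟩

/-- If `√[a, a + s]` is not too short, then a cylinder in `[1 - r, 1]` can be replaced by one of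
its children. -/
theorem exists_child_snd (h : ThickSystem r c K) {u a s b t : ℝ} (ht : 0 < t) (htr : t ≤ r)
    (hb : IsCylinder K b t) (hb1 : 1 - r ≤ b) (hs : 0 ≤ s) (has : r ^ 2 / 2 ≤ √(a + s) - √a)
    (H : ∃ p ∈ Icc a (a + s) ×ˢ Icc b (b + t), √p.1 + √p.2 - u = 0) :
    ∃ b', IsCylinder K b' (r * t) ∧ b ≤ b' ∧ b' + r * t ≤ b + t ∧
      ∃ p ∈ Icc a (a + s) ×ˢ Icc b' (b' + r * t), √p.1 + √p.2 - u = 0 := by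
  have hr := h.pos
  have hr2 := h.lt_half
  have hct : 0 < c * t := mul_pos (hr.trans_le h.le) ht
  have hrt : (1 - r) * t ≤ t := by nlinarith
  have hgt : 0 < (1 - r - c) * t := mul_pos (by linarith [h.lt]) ht
  have hsq1 : 1 - r ≤ √(1 - r) := Real.le_sqrt_of_sq_le (by nlinarith)
  have h1 : √(1 - r) ≤ √(b + (1 - r) * t) := Real.sqrt_le_sqrt (by linarith)
  have h2 : √(1 - r) ≤ √(b + c * t) := Real.sqrt_le_sqrt (by linarith)
  have hgap : √(b + (1 - r) * t) - √(b + c * t) ≤ √(a + s) - √a := by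
    refine le_trans ?_ has
    have e : (√(b + (1 - r) * t) - √(b + c * t)) * (√(b + (1 - r) * t) + √(b + c * t)) =
        (1 - r - c) * t := by
      nlinarith [Real.sq_sqrt (show 0 ≤ b + (1 - r) * t by linarith),
        Real.sq_sqrt (show 0 ≤ b + c * t by linarith)]
    refine le_of_mul_le_mul_right ?_
      (show 0 < √(b + (1 - r) * t) + √(b + c * t) by linarith)
    rw [e]
    -- The image of the gap has length at most `r ^ 2 / 2`: both roots in the conjugate factor are
    -- at least `1 - r`.
    calc (1 - r - c) * t ≤ (r * (1 - r)) * r :=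
          mul_le_mul h.gap_le htr ht.le (mul_nonneg hr.le (by linarith))
      _ = r ^ 2 / 2 * (2 * (1 - r)) := by ring
      _ ≤ _ := mul_le_mul_of_nonneg_left (by linarith) (by positivity)
  obtain ⟨⟨x, y⟩, ⟨⟨hx1, hx2⟩, hy1, hy2⟩, e⟩ := H
  dsimp only at hx1 hx2 hy1 hy2 e
  have hlo : √a + √b ≤ u := by
    linarith [Real.sqrt_le_sqrt hx1, Real.sqrt_le_sqrt hy1]
  have hhi : u ≤ √(a + s) + √(b + t) := by
    linarith [Real.sqrt_le_sqrt hx2, Real.sqrt_le_sqrt hy2]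
  have key : ∃ p ∈ Icc a (a + s) ×ˢ gapSet r c b t, √p.1 + √p.2 - u = 0 := by
    rcases le_total u (√(a + s) + √(b + c * t)) with h3 | h3
    · obtain ⟨p, hp, e⟩ := exists_sqrt_add_sqrt_eq hs hct.le hlo h3
      exact ⟨p, ⟨hp.1, Or.inl hp.2⟩, e⟩
    · obtain ⟨p, hp, e⟩ := exists_sqrt_add_sqrt_eq (a := a) (s := s) (b := b + (1 - r) * t)
        (t := t - (1 - r) * t) (u := u) hs (by linarith) (by linarith)
        (by rwa [show b + (1 - r) * t + (t - (1 - r) * t) = b + t by ring])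
      rw [show b + (1 - r) * t + (t - (1 - r) * t) = b + t by ring] at hp
      exact ⟨p, ⟨hp.1, Or.inr hp.2⟩, e⟩
  obtain ⟨⟨x, y⟩, ⟨hx, hy⟩, e⟩ := key
  obtain ⟨b', hb', h3, h4, hy'⟩ := h.exists_child ht hb hy
  exact ⟨b', hb', h3, h4, (x, y), ⟨hx, hy'⟩, e⟩

theorem gap_sq_le (h : ThickSystem r c K) : (1 - r - c) ^ 2 ≤ r ^ 2 * (1 - r) := by
  have hr := h.pos
  have hr2 := h.lt_half
  calc (1 - r - c) ^ 2 ≤ (r * (1 - r)) ^ 2 :=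
        pow_le_pow_left₀ (by linarith [h.lt]) h.gap_le 2
    _ = r ^ 2 * (1 - r) * (1 - r) := by ring
    _ ≤ r ^ 2 * (1 - r) * 1 :=
        mul_le_mul_of_nonneg_left (by linarith) (mul_nonneg (sq_nonneg r) (by linarith))
    _ = _ := mul_one _

/-- The right copy is too long for the equal-size box lemma, so it is first shrunk to a child of
length `r * r`. -/
theorem exists_sqrt_of_second_order_box (h : ThickSystem r c K) {u a : ℝ}
    (ha : IsCylinder K a (r * r)) (hga : (1 - r - c) ^ 2 ≤ a) (ha1 : a + r * r ≤ 1)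
    (hlo : √a + √(1 - r) ≤ u) (hhi : u ≤ √(a + r * r) + 1) :
    ∃ x ∈ K, ∃ y ∈ K, u = √x + √y := by
  have hr := h.pos
  have hr2 := h.lt_half
  have hB : IsCylinder K (1 - r) r := by simpa using h.isCylinder_right h.isCylinder_whole
  have ha0 : 0 ≤ a := (sq_nonneg _).trans hga
  have hrr : 0 < r * r := mul_pos hr hr
  obtain ⟨b, hb, hb1, hb2, H⟩ := h.exists_child_snd hr le_rfl hB le_rfl hrr.le
    (by simpa [sq] using half_le_sqrt_sub_sqrt ha0 hrr.le ha1)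
    (exists_sqrt_add_sqrt_eq hrr.le hr.le hlo (by simpa using hhi))
  have hg1 : (1 - r - c) ^ 2 ≤ 1 - r := by nlinarith [h.gap_sq_le]
  refine h.exists_sqrt_of_box hrr ha hb ?_ ?_ ha0 (by linarith) H
  · nlinarith [sq_nonneg (1 - r - c)]
  · nlinarith [sq_nonneg (1 - r - c)]

/-- The cylinder `[(1 - r) * r ^ 2, r ^ 2]` has length `r ^ 3`, so the right copy is shrunk twice.
Near `0` the square root stretches enough for `r - r * √(1 - r) ≥ r ^ 2 / 2`. -/
theorem exists_sqrt_of_third_order_box (h : ThickSystem r c K) {u : ℝ}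
    (hlo : (1 + r) * √(1 - r) ≤ u) (hhi : u ≤ r + 1) :
    ∃ x ∈ K, ∃ y ∈ K, u = √x + √y := by
  have hr := h.pos
  have hr2 := h.lt_half
  have hB : IsCylinder K (1 - r) r := by simpa using h.isCylinder_right h.isCylinder_whole
  have hA : IsCylinder K ((1 - r) * r ^ 2) (r * (r * r)) := by
    have := h.isCylinder_right (h.isCylinder_left (h.isCylinder_left h.isCylinder_whole))
    simpa [sq] using this
  have hrr : 0 < r * r := mul_pos hr hr
  have hrrr : 0 < r * (r * r) := mul_pos hr hrr
  have e1 : √((1 - r) * r ^ 2) = r * √(1 - r) := by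
    rw [Real.sqrt_mul (by linarith), Real.sqrt_sq hr.le, mul_comm]
  have e2 : √((1 - r) * r ^ 2 + r * (r * r)) = r := by
    rw [show (1 - r) * r ^ 2 + r * (r * r) = r ^ 2 by ring, Real.sqrt_sq hr.le]
  have hsize : r ^ 2 / 2 ≤ √((1 - r) * r ^ 2 + r * (r * r)) - √((1 - r) * r ^ 2) := by
    rw [e1, e2]
    nlinarith [mul_le_mul_of_nonneg_left (sqrt_one_sub_le (show r ≤ 2 by linarith)) hr.le]
  obtain ⟨b, hb, hb1, hb2, H⟩ := h.exists_child_snd hr le_rfl hB le_rfl hrrr.le hsize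
    (exists_sqrt_add_sqrt_eq (u := u) hrrr.le hr.le (by rw [e1]; linarith)
      (by rw [e2]; simpa using hhi))
  obtain ⟨b', hb', hb1', hb2', H'⟩ := h.exists_child_snd hrr (by nlinarith) hb hb1 hrrr.le hsize H
  have hg := h.gap_sq_le
  refine h.exists_sqrt_of_box hrrr hA hb' ?_ ?_ (mul_nonneg (by linarith) (sq_nonneg r))
    (by linarith) H'
  · calc _ ≤ (r ^ 2 * (1 - r)) * ((1 - r) * r ^ 2 + r * (r * r)) :=
          mul_le_mul_of_nonneg_right hg (by nlinarith)
      _ = (1 - r) * r ^ 4 := by ring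
      _ ≤ (1 - r) * 1 := mul_le_mul_of_nonneg_left (pow_le_one₀ hr.le (by linarith)) (by linarith)
      _ ≤ b' := by linarith
  · nlinarith [sq_nonneg (1 - r - c)]

theorem exists_sqrt_of_top (h : ThickSystem r c K) {u : ℝ}
    (hlo : 2 * √(1 - r) ≤ u) (hhi : u ≤ 2) : ∃ x ∈ K, ∃ y ∈ K, u = √x + √y := by
  have hr := h.pos
  have hr2 := h.lt_half
  have hB : IsCylinder K (1 - r) r := by simpa using h.isCylinder_right h.isCylinder_whole
  have hg1 : (1 - r - c) ^ 2 * (1 - r + r) ≤ 1 - r := by nlinarith [h.gap_sq_le]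
  refine h.exists_sqrt_of_box hr hB hB hg1 hg1 (by linarith) (by linarith)
    (exists_sqrt_add_sqrt_eq hr.le hr.le (by linarith) ?_)
  simp only [sub_add_cancel, Real.sqrt_one]
  linarith

theorem two_sqrt_one_sub_le (h : ThickSystem r c K) : 2 * √(1 - r) ≤ √c + 1 := by
  have h1 : 1 - r ≤ √c := Real.le_sqrt_of_sq_le h.thick
  linarith [sqrt_one_sub_le (show r ≤ 2 by linarith [h.lt_half])]

/-- Here the middle copy is far enough from `0`: middle-middle, middle-right and right-right boxes
cover `[2 * √r, 2]`. -/
theorem exists_sqrt_of_gap_sq_le_sub (h : ThickSystem r c K) (hg : (1 - r - c) ^ 2 ≤ c - r) {u : ℝ}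
    (hlo : 2 * √r ≤ u) (hhi : u ≤ 2) : ∃ x ∈ K, ∃ y ∈ K, u = √x + √y := by
  have hr := h.pos
  have hr2 := h.lt_half
  have hle := h.le
  have hlt := h.lt
  have hB : IsCylinder K (1 - r) r := by simpa using h.isCylinder_right h.isCylinder_whole
  have hA : IsCylinder K (c - r) r := by simpa using h.isCylinder_mid h.isCylinder_whole
  have hgc : (1 - r - c) ^ 2 * c ≤ (1 - r - c) ^ 2 :=
    mul_le_of_le_one_right (sq_nonneg _) (by linarith)
  have hg1 : (1 - r - c) ^ 2 ≤ 1 - r := by linarith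
  rcases le_total (2 * √(1 - r)) u with h1 | h1
  · exact h.exists_sqrt_of_top h1 hhi
  rcases le_total (√(c - r) + √(1 - r)) u with h2 | h2
  · refine h.exists_sqrt_of_box hr hA hB ?_ ?_ (by linarith) (by linarith)
      (exists_sqrt_add_sqrt_eq hr.le hr.le h2 ?_) <;>
      simp only [sub_add_cancel, Real.sqrt_one]
    · linarith
    · linarith
    · exact h1.trans h.two_sqrt_one_sub_le
  · refine h.exists_sqrt_of_box hr hA hA ?_ ?_ (by linarith) (by linarith)
      (exists_sqrt_add_sqrt_eq hr.le hr.le ?_ ?_) <;>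
      try simp only [sub_add_cancel]
    · linarith
    · linarith
    · linarith [Real.sqrt_le_sqrt (show c - r ≤ r by linarith [h.le_two])]
    · have : (√(c - r) + √(1 - r)) / 2 ≤ √c := by
        refine Real.le_sqrt_of_sq_le ?_
        nlinarith [Real.sq_sqrt (show 0 ≤ c - r by linarith),
          Real.sq_sqrt (show 0 ≤ 1 - r by linarith), sq_nonneg (√(c - r) - √(1 - r)), h.thick]
      linarith

theorem exists_sqrt_of_sub_lt_gap_sq (h : ThickSystem r c K) (hg : c - r < (1 - r - c) ^ 2)
    {u : ℝ} (hlo : 2 * √r ≤ u) (hhi : u ≤ 2) : ∃ x ∈ K, ∃ y ∈ K, u = √x + √y := by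
  have hr := h.pos
  have hr2 := h.lt_half
  have hle := h.le
  have hlt := h.lt
  have hthick := h.thick
  have hgsq := h.gap_sq_le
  -- Near-touching of the middle copy and `0` forces `r` to be large. The value `3 / 10` suffices
  -- for the two final estimates, `(1 + r) ^ 2 * (1 - r) ≤ 4 * r` and `1 ≤ √r + r + r * √r`.
  have hr3 : 3 / 10 ≤ r := by
    by_contra! hcon
    have h1 : (1 - r) ^ 2 ≤ r + r ^ 2 * (1 - r) := by linarith
    nlinarith [mul_pos hr hr]
  have hs0 : 0 < √r := Real.sqrt_pos.2 hr
  have hss : √r ^ 2 = r := Real.sq_sqrt hr.le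
  have hs : 54 / 100 ≤ √r := Real.le_sqrt_of_sq_le (by linarith)
  have hq : √(1 - r) ^ 2 = 1 - r := Real.sq_sqrt (by linarith)
  have hq0 := Real.sqrt_nonneg (1 - r)
  have h13 : √((1 - r) * r) = √(1 - r) * √r := Real.sqrt_mul (by linarith) _
  have hrr1 : r ^ 2 ≤ r := by nlinarith
  rcases le_total (2 * √(1 - r)) u with h1 | h1
  · exact h.exists_sqrt_of_top h1 hhi
  -- The right children of the middle and left copies, then the third-order cylinder, take over from
  -- the middle copy; their ranges overlap in turn.
  rcases le_total (√(c - r * r) + √(1 - r)) u with h2 | h2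
  · have hA : IsCylinder K (c - r * r) (r * r) := by
      have := h.isCylinder_right (h.isCylinder_mid h.isCylinder_whole)
      convert this using 1 <;> ring
    refine h.exists_sqrt_of_second_order_box hA ?_ (by linarith) h2 ?_
    · nlinarith
    · rw [sub_add_cancel]
      exact h1.trans h.two_sqrt_one_sub_le
  rcases le_total (√((1 - r) * r) + √(1 - r)) u with h3 | h3
  · have hA : IsCylinder K ((1 - r) * r) (r * r) := by
      simpa using h.isCylinder_right (h.isCylinder_left h.isCylinder_whole)
    refine h.exists_sqrt_of_second_order_box hA ?_ (by nlinarith) h3 ?_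
    · nlinarith
    · rw [show (1 - r) * r + r * r = r by ring]
      have h4 : √(c - r * r) ≤ √r := Real.sqrt_le_sqrt (by nlinarith)
      have h5 : √(1 - r) ≤ 1 := Real.sqrt_le_one.2 (by linarith)
      linarith
  · refine h.exists_sqrt_of_third_order_box (le_trans ?_ hlo) (h3.trans ?_)
    · refine abs_le_of_sq_le_sq' ?_ (by positivity) |>.2
      rw [mul_pow, mul_pow, hq, hss]
      nlinarith
    · rw [h13]
      refine abs_le_of_sq_le_sq' ?_ (by positivity) |>.2
      rw [show (√(1 - r) * √r + √(1 - r)) ^ 2 = √(1 - r) ^ 2 * (1 + √r) ^ 2 by ring, hq]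
      generalize √r = s at *
      subst hss
      have : 1 ≤ s + s ^ 2 + s ^ 3 := by nlinarith [sq_nonneg s]
      nlinarith

theorem exists_sqrt (h : ThickSystem r c K) {u : ℝ} (hu : u ∈ Icc (0 : ℝ) 1) :
    ∃ x ∈ K, ∃ y ∈ K, u = √x + √y := by
  rcases hu.1.eq_or_lt with rfl | h0
  · exact ⟨0, h.zero_mem, 0, h.zero_mem, by simp⟩
  refine forall_of_fundamental_domain (S := fun u => ∃ x ∈ K, ∃ y ∈ K, u = √x + √y)
    (ρ := √r) (m := 2) (Real.sqrt_pos.2 h.pos) ?_ two_pos ?_ ?_ h0 (by linarith [hu.2])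
  · rw [Real.sqrt_lt' one_pos]
    linarith [h.lt_half]
  · rintro v ⟨x, hx, y, hy, rfl⟩
    refine ⟨r * x, h.left_mem x hx, r * y, h.left_mem y hy, ?_⟩
    rw [Real.sqrt_mul h.pos.le, Real.sqrt_mul h.pos.le]
    ring
  · rintro v ⟨hv1, hv2⟩
    rcases le_or_gt ((1 - r - c) ^ 2) (c - r) with hg | hg
    · exact h.exists_sqrt_of_gap_sq_le_sub hg (by linarith) hv2
    · exact h.exists_sqrt_of_sub_lt_gap_sq hg (by linarith) hv2

end ThickSystem

/-! ### The equivalence. -/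

theorem corollary1p3 (r c : ℝ) (hr0 : 0 < r) (hr1 : r < 1) (K : Set ℝ)
    (hK : IsAttractor (overlapIFS r c) K)
    (hull : convexHull ℝ K = Set.Icc 0 1)
    (h12 : (overlapIFS r c 0 '' Set.Icc 0 1 ∩ overlapIFS r c 1 '' Set.Icc 0 1).Nonempty)
    (h3 : (overlapIFS r c 0 '' Set.Icc 0 1 ∪ overlapIFS r c 1 '' Set.Icc 0 1) ∩
      overlapIFS r c 2 '' Set.Icc 0 1 = ∅) :
    [∀ u ∈ Set.Icc (0 : ℝ) 1, ∃ x ∈ K, ∃ y ∈ K, u = x * y,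
     ∀ u ∈ Set.Icc (0 : ℝ) 1,
       (∃ x₁ ∈ K, ∃ x₂ ∈ K, u = x₁ + x₂) ∧
       (∃ x₃ ∈ K, ∃ x₄ ∈ K, u = x₃ - x₄) ∧
       (∃ x₅ ∈ K, ∃ x₆ ∈ K, u = x₅ * x₆) ∧
       (∃ x₇ ∈ K, ∃ x₈ ∈ K, x₈ ≠ 0 ∧ u = x₇ / x₈) ∧
       (∃ x₉ ∈ K, ∃ x₁₀ ∈ K, u = Real.sqrt x₉ + Real.sqrt x₁₀),
     (1 - r) ^ 2 ≤ c].TFAE := by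
  have hsub : K ⊆ Icc 0 1 := hull ▸ subset_convexHull ℝ K
  have mem_iff : ∀ x, x ∈ K ↔ ∃ i, ∃ y ∈ K, overlapIFS r c i y = x := fun x => by
    conv_lhs => rw [hK.eq_iUnion]
    simp only [mem_iUnion, mem_image]
  have m1 : ∀ x ∈ K, r * x ∈ K := fun x hx => (mem_iff _).2 ⟨0, x, hx, rfl⟩
  have m2 : ∀ x ∈ K, r * x + c - r ∈ K := fun x hx => (mem_iff _).2 ⟨1, x, hx, rfl⟩
  have m3 : ∀ x ∈ K, r * x + 1 - r ∈ K := fun x hx => (mem_iff _).2 ⟨2, x, hx, rfl⟩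
  have zero_mem : (0 : ℝ) ∈ K := by
    by_contra hcon
    have h : convexHull ℝ K ⊆ Ioc 0 1 := convexHull_min
      (fun x hx => ⟨(hsub hx).1.lt_of_ne fun e => hcon (e ▸ hx), (hsub hx).2⟩) (convex_Ioc 0 1)
    rw [hull] at h
    exact lt_irrefl _ (h (left_mem_Icc.2 zero_le_one)).1
  have one_mem : (1 : ℝ) ∈ K := by
    by_contra hcon
    have h : convexHull ℝ K ⊆ Ico 0 1 := convexHull_min
      (fun x hx => ⟨(hsub hx).1, (hsub hx).2.lt_of_ne fun e => hcon (e ▸ hx)⟩) (convex_Ico 0 1)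
    rw [hull] at h
    exact lt_irrefl _ (h (right_mem_Icc.2 zero_le_one)).2
  have hle : r ≤ c := by
    have := (hsub (m2 0 zero_mem)).1
    linarith
  have hle2 : c ≤ 2 * r := by
    obtain ⟨z, ⟨x, hx, rfl⟩, y, hy, e⟩ := h12
    have e' : r * y + c - r = r * x := e
    nlinarith [hx.2, hy.1]
  have hlt : c < 1 - r := by
    by_contra! hcon
    have hc1 : c ≤ 1 := by
      have := (hsub (m2 1 one_mem)).2
      linarith
    have e1 : overlapIFS r c 1 1 = c := show r * 1 + c - r = c by ring
    have e2 : overlapIFS r c 2 ((c - (1 - r)) / r) = c := by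
      change r * ((c - (1 - r)) / r) + 1 - r = c
      rw [mul_div_cancel₀ _ hr0.ne']
      ring
    have hc : c ∈ (∅ : Set ℝ) := h3.le ⟨Or.inr ⟨1, by simp, e1⟩, _,
      ⟨div_nonneg (by linarith) hr0.le, (div_le_one hr0).2 (by linarith)⟩, e2⟩
    exact hc
  tfae_have 3 → 2 := by
    intro hthick u hu
    have h : ThickSystem r c K := ⟨hr0, hle, hle2, hlt, hthick, hK.isCompact, zero_mem, one_mem,
      m1, m2, m3⟩
    exact ⟨h.exists_add hu, h.exists_sub hu, h.exists_mul hu, h.exists_div hu, h.exists_sqrt hu⟩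
  tfae_have 2 → 1 := fun H u hu => (H u hu).2.2.1
  tfae_have 1 → 3 := by
    intro H
    by_contra! hcon
    have split : ∀ x ∈ K, x ≤ c ∨ 1 - r ≤ x := by
      intro x hx
      obtain ⟨i, y, hy, e⟩ := (mem_iff x).1 hx
      obtain ⟨hy0, hy1⟩ := hsub hy
      fin_cases i
      · have e' : r * y = x := e
        left
        nlinarith
      · have e' : r * y + c - r = x := e
        left
        nlinarith
      · have e' : r * y + 1 - r = x := e
        right
        nlinarith
    -- The midpoint of the product gap: a factor at most `c` makes the product too small, two
    -- factors at least `1 - r` make it too large.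
    obtain ⟨x, hx, y, hy, e⟩ := H ((c + (1 - r) ^ 2) / 2) ⟨by nlinarith, by nlinarith⟩
    obtain ⟨hx0, hx1⟩ := hsub hx
    obtain ⟨hy0, hy1⟩ := hsub hy
    rcases split x hx with h1 | h1
    · nlinarith
    rcases split y hy with h2 | h2
    · nlinarith
    · nlinarith
  tfae_finish
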